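/- Let $d\ge 1$. For $j=1,\dots,d$ let $p_j,q_j$ be continuously differentiable functions on $[0,1]$ that are positive on $(0,1)$, with $p_j/q_j$ strictly increasing on $(0,1)$, and suppose that there are a continuously differentiable function $u_j$ and a continuous function $v_j$ on $(0,1)$ such that $f=p_j$ and $f=q_j$ both satisfy the Sturm–Liouville equation $$\frac{\mathrm d}{\mathrm dx}\Bigl(u_j(x)\frac{\mathrm df}{\mathrm dx}(x)\Bigr)+v_j(x)f(x)=0,\qquad x\in(0,1).$$ Let $\{\mathsf Y(\boldsymbol x):\boldsymbol x\in(0,1)^d\}$ be a zero-mean Gaussian process with the tensor Markov kernel $$k(\boldsymbol x,\boldsymbol x')=\prod_{j=1}^d p_j\bigl(\min(x_j,x_j')\bigr)\,q_j\bigl(\max(x_j,x_j')\bigr).$$ For $l\ge1$ put $\mathcal X_l=\{i\,2^{-l}:1\le i\le 2^l-1\}$, and for $\tau\ge 1$ let the sparse grid of level $\tau$ be $$\mathcal X^{\mathsf{SG}}_\tau=\bigcup_{\boldsymbol l\in\{1,2,\dots\}^d,\;l_1+\dots+l_d\le\tau+d-1}\mathcal X_{l_1}\times\dots\times\mathcal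 X_{l_d}.$$ A truncated sparse grid (TSG) of size $n$ is a set $\mathcal X^{\mathsf{SG}}_\tau\cup\mathcal A$, where $\tau\ge1$ satisfies $|\mathcal X^{\mathsf{SG}}_\tau|\le n<|\mathcal X^{\mathsf{SG}}_{\tau+1}|$ and $\mathcal A$ is an arbitrary set of $n-|\mathcal X^{\mathsf{SG}}_\tau|$ points of $\mathcal X^{\mathsf{SG}}_{\tau+1}\setminus\mathcal X^{\mathsf{SG}}_\tau$. For a TSG $\{\boldsymbol x_1,\dots,\boldsymbol x_n\}$ of size $n$ on which $\mathsf Y$ is observed without noise, let $\widehat{\mathsf Y}_n(\boldsymbol x)=\boldsymbol k(\boldsymbol x)^{\top}\boldsymbol K^{-1}\boldsymbol y$ be the kriging predictor, where $\boldsymbol k(\boldsymbol x)=(k(\boldsymbol x,\boldsymbol x_i))_{i}$, $\boldsymbol K=(k(\boldsymbol x_i,\boldsymbol x_{i'}))_{i,i'}$ and $\boldsymbol y=(\mathsf Y(\boldsymbol x_i))_{i}$. Then, as $n\to\infty$, $$\sup_{\boldsymbol x\in(0,1)^d}\mathbb E\bigl[(\widehat{\mathsf Y}_n(\boldsymbol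 x)-\mathsf Y(\boldsymbol x))^2\bigr]=\mathcal O\bigl(n^{-1}(\log n)^{2(d-1)}\bigr),$$ with a constant that may depend on $d$ and on the kernel, but not on the choice of the points in $\mathcal A$. -/

import Mathlib

open MeasureTheory ProbabilityTheory
open scoped Matrix ENNReal

namespace TensorMarkov

/-- The design space `(0,1)^d`. -/
def openCube (d : ℕ) : Set (Fin d → ℝ) := {x | ∀ j, x j ∈ Set.Ioo (0 : ℝ) 1}

/-- The kernel `k(x, x') = ∏ j, p_j (x_j ∧ x'_j) * q_j (x_j ∨ x'_j)`. -/
def tmKernel {d : ℕ} (p q : Fin d → ℝ → ℝ) (x x' : Fin d → ℝ) : ℝ :=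
  ∏ j, p j (min (x j) (x' j)) * q j (max (x j) (x' j))

/-- The conditions on `p_j`, `q_j` under which `tmKernel p q` is a tensor Markov kernel on
`(0,1)^d`: positivity, and `p_j / q_j` strictly increasing. -/
structure IsTensorMarkov {d : ℕ} (p q : Fin d → ℝ → ℝ) : Prop where
  p_pos : ∀ j, ∀ x ∈ Set.Ioo (0 : ℝ) 1, 0 < p j x
  q_pos : ∀ j, ∀ x ∈ Set.Ioo (0 : ℝ) 1, 0 < q j x
  strictMono_div : ∀ j, StrictMonoOn (fun x => p j x / q j x) (Set.Ioo 0 1)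

/-- `f` solves the Sturm–Liouville equation `(u f')' + v f = 0` on `(0,1)`; in particular `u f'`
is differentiable there. -/
def SolvesSturmLiouville (u v f : ℝ → ℝ) : Prop :=
  ∀ x ∈ Set.Ioo (0 : ℝ) 1, HasDerivAt (fun y => u y * deriv f y) (-(v x * f x)) x

/-- Sturm–Liouville regularity: `p_j` and `q_j` are continuously differentiable (up to the
boundary) and both solve one equation `(u_j f')' + v_j f = 0` on `(0,1)`, with `u_j` continuously
differentiable and `v_j` continuous on `(0,1)`. -/
structure SturmLiouvilleRegular {d : ℕ} (p q : Fin d → ℝ → ℝ) : Prop where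
  contDiffOn_p : ∀ j, ContDiffOn ℝ 1 (p j) (Set.Icc 0 1)
  contDiffOn_q : ∀ j, ContDiffOn ℝ 1 (q j) (Set.Icc 0 1)
  ode : ∀ j, ∃ u v : ℝ → ℝ, ContDiffOn ℝ 1 u (Set.Ioo 0 1) ∧ ContinuousOn v (Set.Ioo 0 1) ∧
    SolvesSturmLiouville u v (p j) ∧ SolvesSturmLiouville u v (q j)

/-- `Y`, restricted to `(0,1)^d`, is a zero-mean Gaussian process with covariance kernel `k`. The
values of `Y` outside `(0,1)^d` play no role. -/
structure IsCenteredGP {d : ℕ} {Ω : Type*} [MeasurableSpace Ω] (Y : (Fin d → ℝ) → Ω → ℝ)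
    (k : (Fin d → ℝ) → (Fin d → ℝ) → ℝ) (P : Measure Ω) : Prop where
  gaussian : IsGaussianProcess (fun x : openCube d => Y x) P
  mean_zero : ∀ x ∈ openCube d, ∫ ω, Y x ω ∂P = 0
  cov_eq : ∀ x ∈ openCube d, ∀ x' ∈ openCube d, covariance (Y x) (Y x') P = k x x'

/-- The dyadic one-dimensional design `{i * 2^(-l) : 1 ≤ i ≤ 2^l - 1}` (empty for `l = 0`). -/
noncomputable def dyadicDesign (l : ℕ) : Finset ℝ :=
  (Finset.Icc 1 (2 ^ l - 1)).image fun i : ℕ => (i : ℝ) / 2 ^ l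

/-- The classical sparse grid of level `τ`: the union of the lattices
`dyadicDesign (l 1) × ⋯ × dyadicDesign (l d)` over `l` with all `l j ≥ 1` and
`l 1 + ⋯ + l d ≤ τ + d - 1`. -/
noncomputable def sparseGrid (d τ : ℕ) : Finset (Fin d → ℝ) :=
  ((Fintype.piFinset fun _ : Fin d => Finset.Icc 1 (τ + d - 1)).filter
      fun l => ∑ j, l j ≤ τ + d - 1).biUnion
    fun l => Fintype.piFinset fun j => dyadicDesign (l j)

/-- `D` is a truncated sparse grid of size `n`: with `τ ≥ 1` such that
`|sparseGrid τ| ≤ n < |sparseGrid (τ+1)|`, it consists of `sparseGrid τ` and an arbitrary choice of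
`n - |sparseGrid τ|` points of `sparseGrid (τ+1) \ sparseGrid τ`. -/
def IsTruncatedSparseGrid (d n : ℕ) (D : Finset (Fin d → ℝ)) : Prop :=
  ∃ τ : ℕ, 1 ≤ τ ∧ (sparseGrid d τ).card ≤ n ∧ n < (sparseGrid d (τ + 1)).card ∧
    ∃ A : Finset (Fin d → ℝ), A ⊆ sparseGrid d (τ + 1) \ sparseGrid d τ ∧
      A.card = n - (sparseGrid d τ).card ∧ D = sparseGrid d τ ∪ A

/-- The kernel matrix of `k` on the design `D`. -/
def kernelMatrix {d : ℕ} (k : (Fin d → ℝ) → (Fin d → ℝ) → ℝ) (D : Finset (Fin d → ℝ)) :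
    Matrix D D ℝ := Matrix.of fun a b => k a b

/-- The kriging predictor `k(x)ᵀ K⁻¹ y` from the noiseless observations `y` of `Y` on `D`. -/
noncomputable def krigingPredictor {d : ℕ} {Ω : Type*} (k : (Fin d → ℝ) → (Fin d → ℝ) → ℝ)
    (D : Finset (Fin d → ℝ)) (Y : (Fin d → ℝ) → Ω → ℝ) (x : Fin d → ℝ) (ω : Ω) : ℝ :=
  (fun a : D => k x a) ⬝ᵥ ((kernelMatrix k D)⁻¹ *ᵥ fun a : D => Y a ω)

/-- The mean squared error `E[(Ŷ(x) - Y(x))²]` of the kriging predictor, in `[0, ∞]`. -/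
noncomputable def krigingMSE {d : ℕ} {Ω : Type*} [MeasurableSpace Ω]
    (k : (Fin d → ℝ) → (Fin d → ℝ) → ℝ) (D : Finset (Fin d → ℝ)) (Y : (Fin d → ℝ) → Ω → ℝ)
    (P : Measure Ω) (x : Fin d → ℝ) : ℝ≥0∞ :=
  ∫⁻ ω, ENNReal.ofReal ((krigingPredictor k D Y x ω - Y x ω) ^ 2) ∂P

end TensorMarkov

/-! In `L²(P)` the kriging error at `x` is the squared distance from `Y x` to the span of the
observed values, because the kernel matrix is invertible. Enlarging the design only shrinks this
distance, so the sparse grid inside a truncated one suffices, whatever the extra points are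
(`exists_krigingMSE_le`).

The covariance of `Y` is a product of one-dimensional inner products `⟨φ j s, φ j t⟩`, where `φ j`
is a time-changed Brownian motion with `‖φ j x - φ j a‖² ≤ M |x - a|`. Projecting `φ j (x j)` onto
the nested spans of the dyadic designs and telescoping gives orthogonal increments of squared norm
at most `M 2^(-l)` (`exists_hierarchical_coeff`). Their products over the coordinates, indexed by
multi-indices `l`, are orthogonal and sum to `Y x`. Those with `∑ l j < τ` lie in the span of the
sparse grid, and the others have total squared norm `O(τ^(d-1) 2^(-τ))`
(`exists_mem_span_sparseGrid_norm_sub_sq_le`, `exists_sum_half_pow_le`).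

Since the next grid has `O(τ^(d-1) 2^τ)` points, `2^(-τ) = O(τ^(d-1) / n)`, while `τ = O(log n)`.
The two factors `τ^(d-1)` produce the exponent `2(d-1)`. -/

namespace TensorMarkov

/-! ### Counting multi-indices and sparse grid points; density of dyadic designs -/

section Counting

/-- With the sum fixed, the last `e` coordinates determine the first, and each of them is at most
`m`. -/
theorem card_le_of_forall_sum_eq {e m : ℕ} (s : Finset (Fin (e + 1) → ℕ))
    (hs : ∀ l ∈ s, ∑ j, l j = m) : s.card ≤ (m + 1) ^ e := by
  have hcard : (Fintype.piFinset fun _ : Fin e => Finset.range (m + 1)).card = (m + 1) ^ e := by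
    simp
  rw [← hcard]
  refine Finset.card_le_card_of_injOn (fun l => Fin.tail l) ?_ ?_
  · intro l hl
    have h := hs l hl
    rw [Finset.mem_coe, Fintype.mem_piFinset]
    intro i
    have hi : l i.succ ≤ ∑ j, l j := Finset.single_le_sum (fun _ _ => Nat.zero_le _)
      (Finset.mem_univ _)
    simp only [Finset.mem_range, Fin.tail]
    omega
  · intro l hl l' hl' h
    have h1 := hs l hl
    have h2 := hs l' hl'
    have ht : ∀ i : Fin e, l i.succ = l' i.succ := fun i => congrFun h i
    rw [Fin.sum_univ_succ] at h1 h2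
    simp only [ht] at h1
    funext j
    refine Fin.cases ?_ ht j
    omega

/-- The slice of sum `t + i` has at most `(t + i + 1)^e ≤ ((t + 1)(i + 1))^e` elements. This
separates `t` from `i`, and the remaining series in `i` converges to the constant `C`. -/
theorem exists_sum_half_pow_le (e : ℕ) : ∃ C : ℝ, 0 ≤ C ∧
    ∀ (t : ℕ) (s : Finset (Fin (e + 1) → ℕ)), (∀ l ∈ s, t ≤ ∑ j, l j) →
      ∑ l ∈ s, (1 / 2 : ℝ) ^ (∑ j, l j) ≤ C * ((t : ℝ) + 1) ^ e * (1 / 2) ^ t := by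
  have hsum : Summable fun i : ℕ => ((i : ℝ) + 1) ^ e * (1 / 2 : ℝ) ^ i := by
    have h := (summable_nat_add_iff 1).2
      (summable_pow_mul_geometric_of_norm_lt_one e (r := (1 / 2 : ℝ)) (by norm_num))
    refine (h.mul_left 2).congr fun i => ?_
    push_cast
    ring
  refine ⟨∑' i : ℕ, ((i : ℝ) + 1) ^ e * (1 / 2 : ℝ) ^ i, tsum_nonneg fun i => by positivity, ?_⟩
  intro t s hs
  rw [← Finset.sum_fiberwise_of_maps_to (s := s) (t := s.image fun l => ∑ j, l j - t)
    (g := fun l => ∑ j, l j - t) fun l hl => Finset.mem_image_of_mem _ hl]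
  calc _ ≤ ∑ i ∈ s.image fun l => ∑ j, l j - t,
        ((t : ℝ) + 1) ^ e * (1 / 2) ^ t * (((i : ℝ) + 1) ^ e * (1 / 2 : ℝ) ^ i) := by
        refine Finset.sum_le_sum fun i _ => ?_
        have hmem : ∀ l ∈ s.filter (fun l => ∑ j, l j - t = i), ∑ j, l j = t + i := by
          intro l hl
          rw [Finset.mem_filter] at hl
          have := hs l hl.1
          omega
        rw [Finset.sum_congr rfl fun l hl => by rw [hmem l hl], Finset.sum_const, nsmul_eq_mul]
        have h1 : ((s.filter (fun l => ∑ j, l j - t = i)).card : ℝ) ≤ ((t : ℝ) + i + 1) ^ e := by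
          exact_mod_cast card_le_of_forall_sum_eq _ hmem
        have h2 : ((t : ℝ) + i + 1) ^ e ≤ (((t : ℝ) + 1) * (i + 1)) ^ e := by
          refine pow_le_pow_left₀ (by positivity) ?_ e
          nlinarith [mul_nonneg (Nat.cast_nonneg (α := ℝ) t) (Nat.cast_nonneg (α := ℝ) i)]
        calc _ ≤ (((t : ℝ) + 1) * (i + 1)) ^ e * (1 / 2 : ℝ) ^ (t + i) := by
              gcongr
              exact h1.trans h2
          _ = _ := by rw [mul_pow, pow_add]; ring
    _ = ((t : ℝ) + 1) ^ e * (1 / 2) ^ t *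
        ∑ i ∈ s.image fun l => ∑ j, l j - t, (((i : ℝ) + 1) ^ e * (1 / 2 : ℝ) ^ i) := by
        rw [Finset.mul_sum]
    _ ≤ ((t : ℝ) + 1) ^ e * (1 / 2) ^ t * ∑' i : ℕ, ((i : ℝ) + 1) ^ e * (1 / 2 : ℝ) ^ i := by
        gcongr
        exact hsum.sum_le_tsum _ fun i _ => by positivity
    _ = _ := by ring

theorem card_dyadicDesign_le (l : ℕ) : (dyadicDesign l).card ≤ 2 ^ l := by
  refine Finset.card_image_le.trans ?_
  simp

theorem card_dyadicDesign (l : ℕ) : (dyadicDesign l).card = 2 ^ l - 1 := by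
  rw [dyadicDesign, Finset.card_image_of_injective, Nat.card_Icc]
  · omega
  · intro a b h
    have h2 : (2 : ℝ) ^ l ≠ 0 := by positivity
    exact_mod_cast (div_left_inj' h2).1 h

theorem card_sparseGrid_le (e τ : ℕ) :
    (sparseGrid (e + 1) τ).card ≤ (τ + e + 1) ^ e * 2 ^ (τ + e + 1) := by
  refine Finset.card_biUnion_le.trans ?_
  set s := (Fintype.piFinset fun _ : Fin (e + 1) => Finset.Icc 1 (τ + (e + 1) - 1)).filter
      fun l => ∑ j, l j ≤ τ + (e + 1) - 1 with hs
  calc _ ≤ ∑ l ∈ s, 2 ^ (∑ j, l j) := by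
        refine Finset.sum_le_sum fun l _ => ?_
        rw [Fintype.card_piFinset, ← Finset.prod_pow_eq_pow_sum]
        exact Finset.prod_le_prod' fun j _ => card_dyadicDesign_le _
    _ = ∑ m ∈ Finset.range (τ + e + 1), ∑ l ∈ s.filter (fun l => ∑ j, l j = m),
          2 ^ (∑ j, l j) := by
        rw [Finset.sum_fiberwise_of_maps_to]
        intro l hl
        have := (Finset.mem_filter.1 hl).2
        rw [Finset.mem_range]
        omega
    _ ≤ ∑ m ∈ Finset.range (τ + e + 1), (τ + e + 1) ^ e * 2 ^ m := by
        refine Finset.sum_le_sum fun m hm => ?_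
        have hmem : ∀ l ∈ s.filter (fun l => ∑ j, l j = m), ∑ j, l j = m :=
          fun l hl => (Finset.mem_filter.1 hl).2
        rw [Finset.sum_congr rfl fun l hl => by rw [hmem l hl], Finset.sum_const, smul_eq_mul]
        refine Nat.mul_le_mul_right _ ((card_le_of_forall_sum_eq _ hmem).trans ?_)
        exact Nat.pow_le_pow_left (by have := Finset.mem_range.1 hm; omega) e
    _ ≤ _ := by
        rw [← Finset.mul_sum]
        exact Nat.mul_le_mul_left _ (Nat.geomSum_lt le_rfl fun k hk => Finset.mem_range.1 hk).le

theorem mem_sparseGrid {d τ : ℕ} {x : Fin d → ℝ} : x ∈ sparseGrid d τ ↔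
    ∃ l : Fin d → ℕ, (∀ j, 1 ≤ l j) ∧ ∑ j, l j ≤ τ + d - 1 ∧ ∀ j, x j ∈ dyadicDesign (l j) := by
  simp only [sparseGrid, Finset.mem_biUnion, Finset.mem_filter, Fintype.mem_piFinset,
    Finset.mem_Icc]
  constructor
  · rintro ⟨l, ⟨h1, h2⟩, h3⟩
    exact ⟨l, fun j => (h1 j).1, h2, h3⟩
  · rintro ⟨l, h1, h2, h3⟩
    exact ⟨l, ⟨fun j => ⟨h1 j, (Finset.single_le_sum (fun _ _ => Nat.zero_le _)
      (Finset.mem_univ j)).trans h2⟩, h2⟩, h3⟩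

theorem half_mem_dyadicDesign_one : (1 / 2 : ℝ) ∈ dyadicDesign 1 := by
  simp [dyadicDesign]

/-- A single line of the grid, of level `τ` in the first coordinate and through `1/2` in the others,
is enough to force `τ = O(log n)`. -/
theorem two_pow_sub_one_le_card_sparseGrid {e τ : ℕ} (hτ : 1 ≤ τ) :
    2 ^ τ - 1 ≤ (sparseGrid (e + 1) τ).card := by
  rw [← card_dyadicDesign]
  refine Finset.card_le_card_of_injOn (fun t => Fin.cons t fun _ => 1 / 2) ?_ ?_
  · intro t ht
    rw [Finset.mem_coe, mem_sparseGrid]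
    refine ⟨Fin.cons τ fun _ => 1, fun j => ?_, ?_, fun j => ?_⟩
    · refine Fin.cases hτ (fun _ => le_rfl) j
    · rw [Fin.sum_univ_succ]
      simp
    · refine Fin.cases ht (fun _ => half_mem_dyadicDesign_one) j
  · intro a _ b _ h
    exact congrFun h 0

theorem dyadicDesign_subset_Ioo {l : ℕ} {a : ℝ} (ha : a ∈ dyadicDesign l) :
    a ∈ Set.Ioo (0 : ℝ) 1 := by
  simp only [dyadicDesign, Finset.mem_image, Finset.mem_Icc] at ha
  obtain ⟨i, ⟨h1, h2⟩, rfl⟩ := ha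
  have hpos : (0 : ℝ) < 2 ^ l := by positivity
  have h3 : i < 2 ^ l := by have := Nat.one_le_two_pow (n := l); omega
  refine ⟨div_pos (by exact_mod_cast h1) hpos, (div_lt_one hpos).2 (by exact_mod_cast h3)⟩

theorem dyadicDesign_mono : Monotone dyadicDesign := by
  refine monotone_nat_of_le_succ fun l a ha => ?_
  simp only [dyadicDesign, Finset.mem_image, Finset.mem_Icc] at ha ⊢
  obtain ⟨i, ⟨h1, h2⟩, rfl⟩ := ha
  refine ⟨2 * i, ⟨by omega, by rw [pow_succ]; omega⟩, ?_⟩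
  push_cast
  rw [pow_succ]
  field_simp

theorem exists_mem_dyadicDesign_abs_sub_le {l : ℕ} (hl : 1 ≤ l) {x : ℝ}
    (hx : x ∈ Set.Ioo (0 : ℝ) 1) : ∃ a ∈ dyadicDesign l, |x - a| ≤ (1 / 2) ^ l := by
  have hpos : (0 : ℝ) < 2 ^ l := by positivity
  have hx0 : 0 ≤ x * 2 ^ l := mul_nonneg hx.1.le hpos.le
  have hlt : ⌊x * 2 ^ l⌋₊ < 2 ^ l := by
    rw [Nat.floor_lt hx0]
    push_cast
    nlinarith [hx.2]
  have h2 : 2 ≤ 2 ^ l := by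
    calc 2 = 2 ^ 1 := rfl
      _ ≤ 2 ^ l := Nat.pow_le_pow_right (by norm_num) hl
  -- Round down to the lattice, except in the first cell, where `0` is not a design point and
  -- `2^(-l)` serves instead.
  refine ⟨((max 1 ⌊x * 2 ^ l⌋₊ : ℕ) : ℝ) / 2 ^ l, ?_, ?_⟩
  · refine Finset.mem_image.2 ⟨_, Finset.mem_Icc.2 ⟨le_max_left _ _, ?_⟩, rfl⟩
    omega
  · have h3 : x - ((max 1 ⌊x * 2 ^ l⌋₊ : ℕ) : ℝ) / 2 ^ l
        = (x * 2 ^ l - ((max 1 ⌊x * 2 ^ l⌋₊ : ℕ) : ℝ)) / 2 ^ l := by field_simp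
    rw [h3, abs_div, abs_of_pos hpos, one_div, inv_pow, div_eq_mul_inv]
    refine mul_le_of_le_one_left (by positivity) ?_
    have h4 := Nat.floor_le hx0
    have h5 := Nat.lt_floor_add_one (x * 2 ^ l)
    rw [Nat.cast_max, Nat.cast_one, abs_le]
    rcases le_total (1 : ℝ) (⌊x * 2 ^ l⌋₊ : ℝ) with h | h
    · rw [max_eq_right h]; constructor <;> linarith
    · rw [max_eq_left h]; constructor <;> linarith

end Counting

end TensorMarkov

namespace TensorMarkov

/-! ### Orthogonal hierarchical decomposition and sparse grid approximation in Hilbert space -/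

section Hilbert

variable {H H' : Type*} [NormedAddCommGroup H] [InnerProductSpace ℝ H]
  [NormedAddCommGroup H'] [InnerProductSpace ℝ H']

theorem exists_coeff_of_mem_span {α : Type*} {φ : α → H} {s : Set α} {v : H}
    (hv : v ∈ Submodule.span ℝ (φ '' s)) : ∃ c : α →₀ ℝ, (c.support : Set α) ⊆ s ∧
      ∀ G : Finset α, c.support ⊆ G → ∑ a ∈ G, c a • φ a = v := by
  obtain ⟨c, hc, rfl⟩ := (Finsupp.mem_span_image_iff_linearCombination ℝ).1 hv
  refine ⟨c, hc, fun G hG => ?_⟩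
  rw [Finsupp.linearCombination_apply, Finsupp.sum_of_support_subset c hG _ (by simp)]

theorem norm_sum_sq_of_pairwise_inner_eq_zero {ι : Type*} (s : Finset ι) (f : ι → H)
    (hf : ∀ i ∈ s, ∀ j ∈ s, i ≠ j → inner ℝ (f i) (f j) = 0) :
    ‖∑ i ∈ s, f i‖ ^ 2 = ∑ i ∈ s, ‖f i‖ ^ 2 := by
  rw [← real_inner_self_eq_norm_sq, sum_inner]
  refine Finset.sum_congr rfl fun i hi => ?_
  rw [inner_sum, Finset.sum_eq_single_of_mem i hi fun j hj hji => hf i hi j hj hji.symm,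
    real_inner_self_eq_norm_sq]

theorem norm_sub_starProjection_le (V : Submodule ℝ H) [V.HasOrthogonalProjection] (y : H)
    {v : H} (hv : v ∈ V) : ‖y - V.starProjection y‖ ≤ ‖y - v‖ := by
  rw [Submodule.starProjection_minimal]
  exact ciInf_le ⟨0, by rintro _ ⟨z, rfl⟩; exact norm_nonneg _⟩ (⟨v, hv⟩ : V)

/-- Successive differences of the projections of `y` on an increasing chain of subspaces are
pairwise orthogonal. -/
theorem inner_starProjection_sub_eq_zero {V : ℕ → Submodule ℝ H}
    [∀ l, (V l).HasOrthogonalProjection] (hV : Monotone V) (y : H) {l m : ℕ} (hlm : l ≠ m) :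
    inner ℝ ((V (l + 1)).starProjection y - (V l).starProjection y)
      ((V (m + 1)).starProjection y - (V m).starProjection y) = 0 := by
  wlog h : l < m generalizing l m
  · rw [real_inner_comm]
    exact this hlm.symm (by omega)
  have h1 : (V (l + 1)).starProjection y - (V l).starProjection y ∈ V m :=
    Submodule.sub_mem _ (hV h (Submodule.starProjection_apply_mem _ _))
      (hV h.le (Submodule.starProjection_apply_mem _ _))
  have h2 : (V (m + 1)).starProjection y - (V m).starProjection y
      = (y - (V m).starProjection y) - (y - (V (m + 1)).starProjection y) := by abel
  rw [h2, inner_sub_right,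
    Submodule.inner_right_of_mem_orthogonal h1 (Submodule.sub_starProjection_mem_orthogonal y),
    Submodule.inner_right_of_mem_orthogonal (hV (Nat.le_succ m) h1)
      (Submodule.sub_starProjection_mem_orthogonal y), sub_zero]

theorem norm_starProjection_sub_le {U V : Submodule ℝ H} [U.HasOrthogonalProjection]
    [V.HasOrthogonalProjection] (hUV : U ≤ V) (y : H) :
    ‖V.starProjection y - U.starProjection y‖ ≤ ‖y - U.starProjection y‖ := by
  have h : V.starProjection y - U.starProjection y
      = V.starProjection (y - U.starProjection y) := by
    rw [map_sub, Submodule.starProjection_eq_self_iff.2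
      (hUV (Submodule.starProjection_apply_mem U y))]
  rw [h]
  exact Submodule.norm_starProjection_apply_le _ _

/-- The hierarchical decomposition of the point mass at `x` along the dyadic designs: the level `l`
part is supported on `dyadicDesign (l + 1)` for `l < τ`, the parts are orthogonal in the feature
space, and they decay geometrically. -/
theorem exists_hierarchical_coeff {φ : ℝ → H} {M : ℝ}
    (hM : ∀ x ∈ Set.Ioo (0 : ℝ) 1, ‖φ x‖ ^ 2 ≤ M)
    (hL : ∀ x ∈ Set.Ioo (0 : ℝ) 1, ∀ a ∈ Set.Ioo (0 : ℝ) 1, ‖φ x - φ a‖ ^ 2 ≤ M * |x - a|)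
    (τ : ℕ) {x : ℝ} (hx : x ∈ Set.Ioo (0 : ℝ) 1) : ∃ c : ℕ → ℝ → ℝ,
      (∀ l < τ, ∀ a, c l a ≠ 0 → a ∈ dyadicDesign (l + 1)) ∧
      (∀ a, ∑ l ∈ Finset.range (τ + 1), c l a = if a = x then 1 else 0) ∧
      (∀ l ≤ τ, ∀ m ≤ τ, l ≠ m →
        inner ℝ (∑ a ∈ insert x (dyadicDesign τ), c l a • φ a)
          (∑ a ∈ insert x (dyadicDesign τ), c m a • φ a) = 0) ∧
      (∀ l ≤ τ, ‖∑ a ∈ insert x (dyadicDesign τ), c l a • φ a‖ ^ 2 ≤ M * (1 / 2) ^ l) := by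
  classical
  set G := insert x (dyadicDesign τ) with hG
  -- The chain starts at the empty design of level `0` and is completed above level `τ` by adding
  -- `x` itself. Telescoping is then finite and exact.
  set S : ℕ → Finset ℝ := fun l => if l ≤ τ then dyadicDesign l else G with hS
  have hSG : ∀ l, S l ⊆ G := by
    intro l
    simp only [hS]
    split_ifs with h
    · exact (dyadicDesign_mono h).trans (Finset.subset_insert _ _)
    · exact subset_rfl
  have hSmono : Monotone S := by
    intro l m hlm
    by_cases hm : m ≤ τ
    · simpa only [hS, if_pos hm, if_pos (hlm.trans hm)] using dyadicDesign_mono hlm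
    · simpa only [hS, if_neg hm] using hSG l
  let V : ℕ → Submodule ℝ H := fun l => Submodule.span ℝ (φ '' (S l : Set ℝ))
  have hV : Monotone V := fun l m hlm =>
    Submodule.span_mono (Set.image_mono (Finset.coe_subset.2 (hSmono hlm)))
  have hfin : ∀ l, FiniteDimensional ℝ (V l) := fun l =>
    FiniteDimensional.span_of_finite ℝ ((S l).finite_toSet.image φ)
  have hw : ∀ l, ∃ w : ℝ → ℝ, (∀ a, w a ≠ 0 → a ∈ S l) ∧
      ∑ a ∈ G, w a • φ a = (V l).starProjection (φ x) ∧
      -- At the top the coefficients, not only the vector they represent, must be the point mass: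
      -- products of coefficients are later paired with `ψ`, where only coefficient identities carry
      -- over.
      (l = τ + 1 → ∀ a, w a = if a = x then 1 else 0) := by
    intro l
    by_cases hl : l = τ + 1
    · have hSl : S l = G := by simp [hS, hl]
      have hmem : φ x ∈ V l := Submodule.subset_span
        ⟨x, by rw [hSl]; exact Finset.mem_insert_self _ _, rfl⟩
      refine ⟨fun a => if a = x then 1 else 0, fun a ha => ?_, ?_, fun _ a => rfl⟩
      · have : a = x := by by_contra h; exact ha (if_neg h)
        rw [hSl, this]
        exact Finset.mem_insert_self _ _
      · rw [Submodule.starProjection_eq_self_iff.2 hmem]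
        simp [hG]
    · obtain ⟨c, hc, hcG⟩ := exists_coeff_of_mem_span
        (Submodule.starProjection_apply_mem (V l) (φ x))
      refine ⟨c, fun a ha => hc (Finsupp.mem_support_iff.2 ha), hcG G ?_, fun h => absurd h hl⟩
      exact (Finset.coe_subset.1 hc).trans (hSG l)
  choose w hwS hwP hwx using hw
  have hdiff : ∀ l, ∑ a ∈ G, (w (l + 1) a - w l a) • φ a
      = (V (l + 1)).starProjection (φ x) - (V l).starProjection (φ x) := by
    intro l
    simp only [sub_smul, Finset.sum_sub_distrib, hwP]
  have hw0 : ∀ a, w 0 a = 0 := by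
    intro a
    by_contra h
    simpa [hS, dyadicDesign] using hwS 0 a h
  refine ⟨fun l a => w (l + 1) a - w l a, ?_, ?_, ?_, ?_⟩
  · intro l hl a ha
    have hS1 : S (l + 1) = dyadicDesign (l + 1) := if_pos hl
    rw [← hS1]
    by_contra hn
    have h1 : w (l + 1) a = 0 := by
      by_contra h
      exact hn (hwS _ _ h)
    have h2 : w l a = 0 := by
      by_contra h
      exact hn (hSmono (Nat.le_succ l) (hwS _ _ h))
    exact ha (by simp only [h1, h2, sub_zero])
  · intro a
    rw [Finset.sum_range_sub (fun l => w l a), hw0, sub_zero, hwx _ rfl]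
  · intro l _ m _ hlm
    rw [hdiff, hdiff]
    exact inner_starProjection_sub_eq_zero hV _ hlm
  · intro l hl
    rw [hdiff]
    have h1 := norm_starProjection_sub_le (hV (Nat.le_succ l)) (φ x)
    rcases Nat.eq_zero_or_pos l with rfl | hpos
    · have h2 := h1.trans (norm_sub_starProjection_le (V 0) (φ x) (Submodule.zero_mem _))
      rw [sub_zero] at h2
      calc _ ≤ ‖φ x‖ ^ 2 := pow_le_pow_left₀ (norm_nonneg _) h2 2
        _ ≤ _ := by simpa using hM x hx
    · obtain ⟨a, ha, hxa⟩ := exists_mem_dyadicDesign_abs_sub_le hpos hx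
      have hmem : φ a ∈ V l := Submodule.subset_span ⟨a, by simpa [hS, hl] using ha, rfl⟩
      have h2 := h1.trans (norm_sub_starProjection_le (V l) (φ x) hmem)
      have hM0 : 0 ≤ M := (sq_nonneg _).trans (hM x hx)
      calc _ ≤ ‖φ x - φ a‖ ^ 2 := pow_le_pow_left₀ (norm_nonneg _) h2 2
        _ ≤ M * |x - a| := hL x hx a (dyadicDesign_subset_Ioo ha)
        _ ≤ _ := mul_le_mul_of_nonneg_left hxa hM0

/-- Stands in for a tensor product Hilbert space: combinations of `ψ` with product coefficients
behave like elementary tensors. -/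
theorem inner_sum_prod_smul {d : ℕ} {ψ : (Fin d → ℝ) → H} {φ : Fin d → ℝ → H'}
    {G G' : Fin d → Finset ℝ}
    (hk : ∀ a ∈ Fintype.piFinset G, ∀ b ∈ Fintype.piFinset G',
      inner ℝ (ψ a) (ψ b) = ∏ j, inner ℝ (φ j (a j)) (φ j (b j)))
    (c c' : Fin d → ℝ → ℝ) :
    inner ℝ (∑ a ∈ Fintype.piFinset G, (∏ j, c j (a j)) • ψ a)
        (∑ b ∈ Fintype.piFinset G', (∏ j, c' j (b j)) • ψ b)
      = ∏ j, inner ℝ (∑ a ∈ G j, c j a • φ j a) (∑ b ∈ G' j, c' j b • φ j b) := by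
  simp only [sum_inner, inner_sum, Finset.prod_univ_sum]
  refine Finset.sum_congr rfl fun b hb => Finset.sum_congr rfl fun a ha => ?_
  simp only [real_inner_smul_left, real_inner_smul_right, hk a ha b hb, Finset.prod_mul_distrib]

/-- The sparse grid approximation of a tensor product feature map. -/
theorem exists_mem_span_sparseGrid_norm_sub_sq_le {d : ℕ} (hd : 1 ≤ d) {ψ : (Fin d → ℝ) → H}
    {φ : Fin d → ℝ → H'} {M : ℝ}
    (hk : ∀ a ∈ openCube d, ∀ b ∈ openCube d,
      inner ℝ (ψ a) (ψ b) = ∏ j, inner ℝ (φ j (a j)) (φ j (b j)))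
    (hM : ∀ j, ∀ x ∈ Set.Ioo (0 : ℝ) 1, ‖φ j x‖ ^ 2 ≤ M)
    (hL : ∀ j, ∀ x ∈ Set.Ioo (0 : ℝ) 1, ∀ a ∈ Set.Ioo (0 : ℝ) 1,
      ‖φ j x - φ j a‖ ^ 2 ≤ M * |x - a|)
    (τ : ℕ) {x : Fin d → ℝ} (hx : x ∈ openCube d) :
    ∃ v ∈ Submodule.span ℝ (ψ '' (sparseGrid d τ : Set (Fin d → ℝ))),
      ‖ψ x - v‖ ^ 2 ≤ M ^ d * ∑ l ∈ (Fintype.piFinset fun _ : Fin d =>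
        Finset.range (τ + 1)).filter (fun l => τ ≤ ∑ j, l j), (1 / 2 : ℝ) ^ (∑ j, l j) := by
  classical
  choose c hcS hcx hco hcM using fun j => exists_hierarchical_coeff (hM j) (hL j) τ (hx j)
  set G : Fin d → Finset ℝ := fun j => insert (x j) (dyadicDesign τ) with hG
  have hGcube : ∀ a ∈ Fintype.piFinset G, a ∈ openCube d := by
    intro a ha j
    rcases Finset.mem_insert.1 (Fintype.mem_piFinset.1 ha j) with h | h
    · rw [h]; exact hx j
    · exact dyadicDesign_subset_Ioo h
  set I := Fintype.piFinset fun _ : Fin d => Finset.range (τ + 1) with hI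
  have hIle : ∀ l ∈ I, ∀ j, l j ≤ τ := fun l hl j =>
    Nat.lt_succ_iff.1 (Finset.mem_range.1 (Fintype.mem_piFinset.1 hl j))
  set Z : (Fin d → ℕ) → H := fun l =>
    ∑ a ∈ Fintype.piFinset G, (∏ j, c j (l j) (a j)) • ψ a with hZ
  have hinner : ∀ l m, inner ℝ (Z l) (Z m) = ∏ j, inner ℝ (∑ a ∈ G j, c j (l j) a • φ j a)
      (∑ b ∈ G j, c j (m j) b • φ j b) := fun l m =>
    inner_sum_prod_smul (fun a ha b hb => hk a (hGcube a ha) b (hGcube b hb))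
      (fun j => c j (l j)) (fun j => c j (m j))
  have hsum : ∑ l ∈ I, Z l = ψ x := by
    simp only [hZ]
    rw [Finset.sum_comm]
    have hxG : x ∈ Fintype.piFinset G :=
      Fintype.mem_piFinset.2 fun j => Finset.mem_insert_self _ _
    have hcoef : ∀ a : Fin d → ℝ, ∑ l ∈ I, ∏ j, c j (l j) (a j) = if a = x then 1 else 0 := by
      intro a
      rw [hI, ← Finset.prod_univ_sum (fun _ => Finset.range (τ + 1)) fun j l => c j l (a j)]
      simp only [hcx]
      rw [Finset.prod_ite_zero]
      simp [funext_iff]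
    simp only [← Finset.sum_smul, hcoef]
    simp [hxG]
  refine ⟨∑ l ∈ I.filter (fun l => ¬ τ ≤ ∑ j, l j), Z l, ?_, ?_⟩
  · refine Submodule.sum_mem _ fun l hl => Submodule.sum_mem _ fun a _ => ?_
    by_cases h0 : ∏ j, c j (l j) (a j) = 0
    · rw [h0, zero_smul]
      exact Submodule.zero_mem _
    refine Submodule.smul_mem _ _ (Submodule.subset_span ⟨a, ?_, rfl⟩)
    have hlt : ∑ j, l j < τ := not_le.1 (Finset.mem_filter.1 hl).2
    -- Increment `l j` uses the design of level `l j + 1`. The shift adds `d` to a sum that is at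
    -- most `τ - 1`, which is exactly the sparse grid constraint.
    refine mem_sparseGrid.2 ⟨fun j => l j + 1, fun j => Nat.le_add_left 1 _, ?_, fun j => ?_⟩
    · rw [Finset.sum_add_distrib]
      simp
      omega
    · have hj : l j ≤ ∑ j, l j := Finset.single_le_sum (fun _ _ => Nat.zero_le _)
        (Finset.mem_univ j)
      exact hcS j (l j) (by omega) (a j) (Finset.prod_ne_zero_iff.1 h0 j (Finset.mem_univ j))
  · have hrest : ψ x - ∑ l ∈ I.filter (fun l => ¬ τ ≤ ∑ j, l j), Z l
        = ∑ l ∈ I.filter (fun l => τ ≤ ∑ j, l j), Z l := by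
      rw [← hsum, ← Finset.sum_filter_add_sum_filter_not I (fun l => τ ≤ ∑ j, l j)]
      abel
    -- Pythagoras: distinct multi-indices differ in some coordinate, and that factor of the inner
    -- product vanishes.
    rw [hrest, norm_sum_sq_of_pairwise_inner_eq_zero, Finset.mul_sum]
    · refine Finset.sum_le_sum fun l hl => ?_
      have hl' := hIle l (Finset.mem_filter.1 hl).1
      rw [← real_inner_self_eq_norm_sq, hinner]
      simp only [real_inner_self_eq_norm_sq]
      calc _ ≤ ∏ j, M * (1 / 2 : ℝ) ^ l j :=
            Finset.prod_le_prod (fun j _ => sq_nonneg _) fun j _ => hcM j (l j) (hl' j)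
        _ = _ := by
            rw [Finset.prod_mul_distrib, Finset.prod_pow_eq_pow_sum]
            simp
    · intro l hl m hm hlm
      obtain ⟨j, hj⟩ := Function.ne_iff.1 hlm
      rw [hinner]
      exact Finset.prod_eq_zero (Finset.mem_univ j) (hco j _ (hIle l (Finset.mem_filter.1 hl).1 j)
        _ (hIle m (Finset.mem_filter.1 hm).1 j) hj)

end Hilbert

end TensorMarkov

namespace TensorMarkov

/-! ### One-dimensional Markov kernels, positive definiteness and kriging weights -/

section FeatureMap

/-- With `r = p / q` increasing, the kernel is `q s * q t * min (r s) (r t)`, the covariance of a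
Brownian motion run at time `r` and scaled by `q`. Hence `φ s` is `q s` times the indicator of `(0,
r s]`. -/
theorem exists_markov_featureMap {p q : ℝ → ℝ} (hp : ∀ x ∈ Set.Ioo (0 : ℝ) 1, 0 < p x)
    (hq : ∀ x ∈ Set.Ioo (0 : ℝ) 1, 0 < q x)
    (hpq : StrictMonoOn (fun x => p x / q x) (Set.Ioo 0 1)) :
    ∃ φ : ℝ → Lp ℝ 2 (volume : Measure ℝ), ∀ s ∈ Set.Ioo (0 : ℝ) 1, ∀ t ∈ Set.Ioo (0 : ℝ) 1,
      inner ℝ (φ s) (φ t) = p (min s t) * q (max s t) := by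
  refine ⟨fun s => indicatorConstLp 2 (measurableSet_Ioc (a := (0 : ℝ)) (b := p s / q s))
    measure_Ioc_lt_top.ne (q s), fun s hs t ht => ?_⟩
  rw [L2.inner_indicatorConstLp_indicatorConstLp _ _ measure_Ioc_lt_top.ne measure_Ioc_lt_top.ne,
    Set.Ioc_inter_Ioc, Real.volume_real_Ioc]
  have hr : ∀ x ∈ Set.Ioo (0 : ℝ) 1, 0 < p x / q x := fun x hx => div_pos (hp x hx) (hq x hx)
  have hs0 := (hq s hs).ne'
  have ht0 := (hq t ht).ne'
  rcases le_total s t with h | h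
  · have h1 : p s / q s ≤ p t / q t := (hpq.le_iff_le hs ht).2 h
    rw [min_eq_left h, max_eq_right h, min_eq_left h1, sup_idem, sub_zero,
      max_eq_left (hr s hs).le]
    simp only [smul_eq_mul, RCLike.inner_apply, conj_trivial]
    field_simp
  · have h1 : p t / q t ≤ p s / q s := (hpq.le_iff_le ht hs).2 h
    rw [min_eq_right h, max_eq_left h, min_eq_right h1, sup_idem, sub_zero,
      max_eq_left (hr t ht).le]
    simp only [smul_eq_mul, RCLike.inner_apply, conj_trivial]
    field_simp

/-- For `a ≤ x` the second left-hand side is `‖φ x - φ a‖²`. It equals `(p x - p a) q x - p a (q x -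
q a)`, so boundedness and Lipschitz continuity of `p` and `q` suffice. -/
theorem exists_markov_kernel_bound {p q : ℝ → ℝ} (hp : ContDiffOn ℝ 1 p (Set.Icc 0 1))
    (hq : ContDiffOn ℝ 1 q (Set.Icc 0 1)) :
    ∃ M : ℝ, (∀ x ∈ Set.Ioo (0 : ℝ) 1, p x * q x ≤ M) ∧
      ∀ a ∈ Set.Ioo (0 : ℝ) 1, ∀ x ∈ Set.Ioo (0 : ℝ) 1,
        p x * q x - 2 * (p a * q x) + p a * q a ≤ M * |x - a| := by
  obtain ⟨Kp, hKp⟩ := hp.exists_lipschitzOnWith one_ne_zero (convex_Icc _ _) isCompact_Icc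
  obtain ⟨Kq, hKq⟩ := hq.exists_lipschitzOnWith one_ne_zero (convex_Icc _ _) isCompact_Icc
  obtain ⟨Bp, hBp⟩ := isCompact_Icc.exists_bound_of_continuousOn hp.continuousOn
  obtain ⟨Bq, hBq⟩ := isCompact_Icc.exists_bound_of_continuousOn hq.continuousOn
  have hBp0 : 0 ≤ Bp := (norm_nonneg _).trans (hBp 0 (by simp))
  have hBq0 : 0 ≤ Bq := (norm_nonneg _).trans (hBq 0 (by simp))
  refine ⟨Bp * Bq + (Kp * Bq + Bp * Kq), fun x hx => ?_, fun a ha x hx => ?_⟩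
  · have h1 := hBp x (Set.Ioo_subset_Icc_self hx)
    have h2 := hBq x (Set.Ioo_subset_Icc_self hx)
    calc p x * q x ≤ ‖p x‖ * ‖q x‖ := by rw [← norm_mul]; exact Real.le_norm_self _
      _ ≤ Bp * Bq := mul_le_mul h1 h2 (norm_nonneg _) hBp0
      _ ≤ _ := le_add_of_nonneg_right (by positivity)
  · have hx' := Set.Ioo_subset_Icc_self hx
    have ha' := Set.Ioo_subset_Icc_self ha
    have h1 : |p x - p a| ≤ Kp * |x - a| := by
      simpa [Real.dist_eq] using hKp.dist_le_mul x hx' a ha'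
    have h2 : |q x - q a| ≤ Kq * |x - a| := by
      simpa [Real.dist_eq] using hKq.dist_le_mul x hx' a ha'
    calc p x * q x - 2 * (p a * q x) + p a * q a
        = (p x - p a) * q x - p a * (q x - q a) := by ring
      _ ≤ |(p x - p a) * q x| + |p a * (q x - q a)| := by
          linarith [le_abs_self ((p x - p a) * q x), neg_abs_le (p a * (q x - q a))]
      _ = |p x - p a| * |q x| + |p a| * |q x - q a| := by rw [abs_mul, abs_mul]
      _ ≤ (Kp * |x - a|) * Bq + Bp * (Kq * |x - a|) := by
          gcongr
          · exact hBq x hx'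
          · exact hBp a ha'
      _ ≤ _ := by nlinarith [mul_nonneg (mul_nonneg hBp0 hBq0) (abs_nonneg (x - a))]

variable {H H' : Type*} [NormedAddCommGroup H] [InnerProductSpace ℝ H]
  [NormedAddCommGroup H'] [InnerProductSpace ℝ H']

theorem norm_sub_sq_le_of_markov {p q : ℝ → ℝ} {φ : ℝ → H} {M : ℝ}
    (hφ : ∀ s ∈ Set.Ioo (0 : ℝ) 1, ∀ t ∈ Set.Ioo (0 : ℝ) 1,
      inner ℝ (φ s) (φ t) = p (min s t) * q (max s t))
    (hM : ∀ a ∈ Set.Ioo (0 : ℝ) 1, ∀ x ∈ Set.Ioo (0 : ℝ) 1,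
        p x * q x - 2 * (p a * q x) + p a * q a ≤ M * |x - a|)
    {x a : ℝ} (hx : x ∈ Set.Ioo (0 : ℝ) 1) (ha : a ∈ Set.Ioo (0 : ℝ) 1) :
    ‖φ x - φ a‖ ^ 2 ≤ M * |x - a| := by
  wlog h : a ≤ x generalizing a x
  · rw [norm_sub_rev, abs_sub_comm]
    exact this ha hx (le_of_not_ge h)
  have := hM a ha x hx
  rw [norm_sub_sq_real, ← real_inner_self_eq_norm_sq, ← real_inner_self_eq_norm_sq, hφ x hx x hx,
    hφ x hx a ha, hφ a ha a ha]
  simpa [min_eq_right h, max_eq_left h] using this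

/-- A finitely supported hat function: a combination of the Markov kernel sections which is
biorthogonal to the sections at the points of a given finite set. -/
theorem exists_markov_dual {p q : ℝ → ℝ} {φ : ℝ → H} (hq : ∀ x ∈ Set.Ioo (0 : ℝ) 1, 0 < q x)
    (hpq : StrictMonoOn (fun x => p x / q x) (Set.Ioo 0 1))
    (hφ : ∀ s ∈ Set.Ioo (0 : ℝ) 1, ∀ t ∈ Set.Ioo (0 : ℝ) 1,
      inner ℝ (φ s) (φ t) = p (min s t) * q (max s t))
    (G : Finset ℝ) {b : ℝ} (hb : b ∈ Set.Ioo (0 : ℝ) 1) :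
    ∃ u ∈ Submodule.span ℝ (φ '' Set.Ioo (0 : ℝ) 1), ∀ a ∈ G, a ∈ Set.Ioo (0 : ℝ) 1 →
      inner ℝ u (φ a) = if a = b then 1 else 0 := by
  -- Choose `y < b < z` so close to `b` that no point of `G` other than `b` lies strictly between
  -- `y` and `z`.
  obtain ⟨y, hy, hyG⟩ : ∃ y ∈ Set.Ioo 0 b, ∀ a ∈ G, a < b → a ≤ y := by
    have h : ∀ᶠ y in nhdsWithin b (Set.Iio b), ∀ a ∈ G, a < b → a ≤ y := by
      refine (Filter.eventually_all_finset G).2 fun a _ => ?_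
      by_cases hab : a < b
      · filter_upwards [Ioo_mem_nhdsLT hab] with y hy _ using hy.1.le
      · exact Filter.Eventually.of_forall fun y h => absurd h hab
    obtain ⟨y, h1, h2⟩ := (h.and (Ioo_mem_nhdsLT hb.1)).exists
    exact ⟨y, h2, h1⟩
  obtain ⟨z, hz, hzG⟩ : ∃ z ∈ Set.Ioo b 1, ∀ a ∈ G, b < a → z ≤ a := by
    have h : ∀ᶠ z in nhdsWithin b (Set.Ioi b), ∀ a ∈ G, b < a → z ≤ a := by
      refine (Filter.eventually_all_finset G).2 fun a _ => ?_
      by_cases hab : b < a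
      · filter_upwards [Ioo_mem_nhdsGT hab] with z hz _ using hz.2.le
      · exact Filter.Eventually.of_forall fun y h => absurd h hab
    obtain ⟨z, h1, h2⟩ := (h.and (Ioo_mem_nhdsGT hb.2)).exists
    exact ⟨z, h2, h1⟩
  have hy1 : y ∈ Set.Ioo (0 : ℝ) 1 := ⟨hy.1, hy.2.trans hb.2⟩
  have hz1 : z ∈ Set.Ioo (0 : ℝ) 1 := ⟨hb.1.trans hz.1, hz.2⟩
  have hyb : p y / q y < p b / q b := hpq hy1 hb hy.2
  have hbz : p b / q b < p z / q z := hpq hb hz1 hz.1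
  have hqy := (hq y hy1).ne'
  have hqb := (hq b hb).ne'
  have hqz := (hq z hz1).ne'
  set r : ℝ → ℝ := fun x => p x / q x with hr
  have hpr : ∀ x ∈ Set.Ioo (0 : ℝ) 1, p x = r x * q x := fun x hx => by
    simp only [hr]
    rw [div_mul_cancel₀ _ (hq x hx).ne']
  -- Up to the factor `q a`, pairing with `φ a` gives a second difference of `min (r ·) (r a)` in
  -- the variable `r`. It vanishes for `a ≤ y` and for `a ≥ z`; at `b` the full pairing is `-(q b *
  -- (r z - r b) * (r b - r y))`, whence the normalisation.
  set u₀ : H := ((r z - r b) / q y) • φ y - ((r z - r y) / q b) • φ b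
    + ((r b - r y) / q z) • φ z with hu₀
  have hmem : ∀ s ∈ Set.Ioo (0 : ℝ) 1, φ s ∈ Submodule.span ℝ (φ '' Set.Ioo (0 : ℝ) 1) :=
    fun s hs => Submodule.subset_span ⟨s, hs, rfl⟩
  have hN : -(q b * (r z - r b) * (r b - r y)) ≠ 0 := neg_ne_zero.2 <|
    mul_ne_zero (mul_ne_zero hqb (sub_pos.2 hbz).ne') (sub_pos.2 hyb).ne'
  refine ⟨(-(q b * (r z - r b) * (r b - r y)))⁻¹ • u₀, Submodule.smul_mem _ _
    (Submodule.add_mem _ (Submodule.sub_mem _ (Submodule.smul_mem _ _ (hmem y hy1))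
      (Submodule.smul_mem _ _ (hmem b hb))) (Submodule.smul_mem _ _ (hmem z hz1))), ?_⟩
  intro a haG ha
  rw [real_inner_smul_left, hu₀, inner_add_left, inner_sub_left, real_inner_smul_left,
    real_inner_smul_left, real_inner_smul_left, hφ y hy1 a ha, hφ b hb a ha, hφ z hz1 a ha]
  rcases lt_trichotomy a b with hab | rfl | hab
  · have h1 : a ≤ y := hyG a haG hab
    rw [min_eq_right h1, min_eq_right hab.le, min_eq_right (hab.trans hz.1).le, max_eq_left h1,
      max_eq_left hab.le, max_eq_left (hab.trans hz.1).le, if_neg hab.ne]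
    field_simp
    ring
  · rw [min_eq_left hy.2.le, min_self, min_eq_right hz.1.le, max_eq_right hy.2.le, max_self,
      max_eq_left hz.1.le, if_pos rfl, hpr y hy1, hpr a hb, inv_mul_eq_one₀ hN]
    field_simp
    ring
  · have h1 : z ≤ a := hzG a haG hab
    rw [min_eq_left h1, min_eq_left hab.le, min_eq_left (hy.2.trans hab).le, max_eq_right h1,
      max_eq_right hab.le, max_eq_right (hy.2.trans hab).le, if_neg hab.ne', hpr y hy1, hpr b hb,
      hpr z hz1]
    field_simp
    ring

/-- Positive definiteness of tensor Markov kernels, in terms of the feature map. -/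
theorem eq_zero_of_sum_smul_eq_zero {d : ℕ} {p q : Fin d → ℝ → ℝ} (hTM : IsTensorMarkov p q)
    {ψ : (Fin d → ℝ) → H} {φ : Fin d → ℝ → H'}
    (hφ : ∀ j, ∀ s ∈ Set.Ioo (0 : ℝ) 1, ∀ t ∈ Set.Ioo (0 : ℝ) 1,
      inner ℝ (φ j s) (φ j t) = p j (min s t) * q j (max s t))
    (hk : ∀ a ∈ openCube d, ∀ b ∈ openCube d,
      inner ℝ (ψ a) (ψ b) = ∏ j, inner ℝ (φ j (a j)) (φ j (b j)))
    {D : Finset (Fin d → ℝ)} (hD : ∀ a ∈ D, a ∈ openCube d) {c : D → ℝ}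
    (hc : ∑ a : D, c a • ψ a = 0) : c = 0 := by
  classical
  funext b
  have hb := hD b b.2
  choose u hu hua using fun j => exists_markov_dual (hTM.q_pos j) (hTM.strictMono_div j) (hφ j)
    (D.image fun a => a j) (hb j)
  choose e he heu using fun j => exists_coeff_of_mem_span (hu j)
  -- The product of the one-dimensional dual functions is dual to `ψ b` on `D`, so pairing it with
  -- the vanishing combination isolates `c b`.
  have hinner : ∀ a ∈ D, inner ℝ (∑ t ∈ Fintype.piFinset fun j => (e j).support,
      (∏ j, e j (t j)) • ψ t) (ψ a) = if a = b then 1 else 0 := by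
    intro a ha
    have ha' := hD a ha
    have h := inner_sum_prod_smul (ψ := ψ) (φ := φ) (G := fun j => (e j).support)
      (G' := fun j => {a j}) ?_ (fun j => e j) (fun _ _ => 1)
    · simp only [Finset.prod_const_one, one_smul, Finset.sum_singleton,
        Fintype.piFinset_singleton] at h
      rw [h]
      have h2 : ∀ j, inner ℝ (∑ t ∈ (e j).support, e j t • φ j t) (φ j (a j))
          = if a j = (b : Fin d → ℝ) j then (1 : ℝ) else 0 := fun j => by
        rw [heu j _ subset_rfl, hua j (a j) (Finset.mem_image_of_mem _ ha) (ha' j)]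
      simp only [h2]
      rw [Finset.prod_ite_zero]
      simp [funext_iff]
    · intro t ht s hs
      refine hk t (fun j => he j (Fintype.mem_piFinset.1 ht j)) s fun j => ?_
      rw [Finset.mem_singleton.1 (Fintype.mem_piFinset.1 hs j)]
      exact ha' j
  have h0 := congrArg (fun v => inner ℝ (∑ t ∈ Fintype.piFinset fun j => (e j).support,
      (∏ j, e j (t j)) • ψ t) v) hc
  simp only [inner_sum, real_inner_smul_right, inner_zero_right, hinner _ (Subtype.prop _),
    Subtype.coe_inj] at h0
  simpa using h0

/-- The matrix is a Gram matrix: for a null vector `c`, the combination `∑ c a • ψ a` has norm zero.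
-/
theorem isUnit_det_kernelMatrix {d : ℕ} {k : (Fin d → ℝ) → (Fin d → ℝ) → ℝ}
    {ψ : (Fin d → ℝ) → H} {D : Finset (Fin d → ℝ)}
    (hk : ∀ a ∈ D, ∀ b ∈ D, inner ℝ (ψ a) (ψ b) = k a b)
    (hD : ∀ c : D → ℝ, ∑ a : D, c a • ψ a = 0 → c = 0) : IsUnit (kernelMatrix k D).det := by
  rw [isUnit_iff_ne_zero]
  intro h
  obtain ⟨c, hc, hKc⟩ := Matrix.exists_mulVec_eq_zero_iff.2 h
  refine hc (hD c ?_)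
  rw [← inner_self_eq_zero (𝕜 := ℝ), sum_inner]
  refine Finset.sum_eq_zero fun a _ => ?_
  have h1 := congrFun hKc a
  simp only [Matrix.mulVec, dotProduct, kernelMatrix, Matrix.of_apply, Pi.zero_apply] at h1
  rw [real_inner_smul_left, inner_sum]
  simp only [real_inner_smul_right, hk a a.2 _ (Subtype.prop _)]
  rw [Finset.sum_congr rfl fun b _ => mul_comm _ _, h1, mul_zero]

/-- The kriging weights give the best linear approximation. -/
theorem norm_sub_kriging_le {d : ℕ} {k : (Fin d → ℝ) → (Fin d → ℝ) → ℝ}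
    {ψ : (Fin d → ℝ) → H} {D : Finset (Fin d → ℝ)} {x : Fin d → ℝ}
    (hk : ∀ a ∈ D, ∀ b ∈ D, inner ℝ (ψ a) (ψ b) = k a b)
    (hkx : ∀ b ∈ D, inner ℝ (ψ x) (ψ b) = k x b)
    (hdet : IsUnit (kernelMatrix k D).det) {v : H}
    (hv : v ∈ Submodule.span ℝ (ψ '' (D : Set (Fin d → ℝ)))) :
    ‖ψ x - ∑ a : D, ((fun a : D => k x a) ᵥ* (kernelMatrix k D)⁻¹) a • ψ a‖ ≤ ‖ψ x - v‖ := by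
  set w := (fun a : D => k x a) ᵥ* (kernelMatrix k D)⁻¹ with hw
  set s := ∑ a : D, w a • ψ a with hs
  have hs_mem : s ∈ Submodule.span ℝ (ψ '' (D : Set (Fin d → ℝ))) :=
    Submodule.sum_mem _ fun a _ => Submodule.smul_mem _ _ (Submodule.subset_span ⟨a, a.2, rfl⟩)
  -- The weights satisfy the normal equations `w K = k(x)`, which say that the residual is
  -- orthogonal to the span; Pythagoras then gives optimality.
  have horth : ∀ z ∈ Submodule.span ℝ (ψ '' (D : Set (Fin d → ℝ))),
      inner ℝ (ψ x - s) z = 0 := by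
    intro z hz
    induction hz using Submodule.span_induction with
    | mem z hz =>
      obtain ⟨b, hb, rfl⟩ := hz
      have h1 : w ᵥ* kernelMatrix k D = fun a : D => k x a := by
        rw [hw, Matrix.vecMul_vecMul, Matrix.nonsing_inv_mul _ hdet, Matrix.vecMul_one]
      have h2 := congrFun h1 ⟨b, hb⟩
      simp only [Matrix.vecMul, dotProduct, kernelMatrix, Matrix.of_apply] at h2
      rw [inner_sub_left, hkx b hb, hs, sum_inner]
      simp only [real_inner_smul_left, hk _ (Subtype.prop _) b hb]
      rw [h2, sub_self]
    | zero => exact inner_zero_right _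
    | add z z' _ _ h h' => rw [inner_add_right, h, h', add_zero]
    | smul c z _ h => rw [real_inner_smul_right, h, mul_zero]
  have h1 : ψ x - v = (ψ x - s) + (s - v) := by abel
  refine le_of_sq_le_sq ?_ (norm_nonneg _)
  rw [h1, norm_add_sq_real, horth _ (Submodule.sub_mem _ hs_mem hv)]
  nlinarith [sq_nonneg ‖s - v‖]

end FeatureMap

end TensorMarkov

namespace TensorMarkov

/-! ### The process in `L²` and its kriging error as a norm -/

section GaussianProcess

variable {d : ℕ} {Ω : Type*} [MeasurableSpace Ω] {P : Measure Ω}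
  {Y : (Fin d → ℝ) → Ω → ℝ} {k : (Fin d → ℝ) → (Fin d → ℝ) → ℝ}

theorem IsCenteredGP.memLp_two (hY : IsCenteredGP Y k P) {x : Fin d → ℝ} (hx : x ∈ openCube d) :
    MemLp (Y x) 2 P :=
  (hY.gaussian.hasGaussianLaw_eval ⟨x, hx⟩).memLp_two

theorem IsCenteredGP.integral_mul [IsProbabilityMeasure P] (hY : IsCenteredGP Y k P)
    {x y : Fin d → ℝ} (hx : x ∈ openCube d) (hy : y ∈ openCube d) :
    ∫ ω, Y x ω * Y y ω ∂P = k x y := by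
  have h := covariance_eq_sub (hY.memLp_two hx) (hY.memLp_two hy)
  rw [hY.cov_eq x hx y hy, hY.mean_zero x hx, zero_mul, sub_zero] at h
  exact h.symm

/-- The values of the process on `(0,1)^d` as elements of `L²`. -/
theorem IsCenteredGP.exists_featureMap [IsProbabilityMeasure P] (hY : IsCenteredGP Y k P) :
    ∃ ψ : (Fin d → ℝ) → Lp ℝ 2 P, (∀ x ∈ openCube d, ψ x =ᵐ[P] Y x) ∧
      ∀ x ∈ openCube d, ∀ y ∈ openCube d, inner ℝ (ψ x) (ψ y) = k x y := by
  classical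
  have hψ : ∀ x ∈ openCube d, (if h : x ∈ openCube d then (hY.memLp_two h).toLp (Y x)
      else 0 : Lp ℝ 2 P) =ᵐ[P] Y x := by
    intro x hx
    rw [dif_pos hx]
    exact MemLp.coeFn_toLp _
  refine ⟨fun x => if h : x ∈ openCube d then (hY.memLp_two h).toLp (Y x) else 0, hψ,
    fun x hx y hy => ?_⟩
  rw [L2.inner_def, ← hY.integral_mul hx hy]
  refine integral_congr_ae ?_
  filter_upwards [hψ x hx, hψ y hy] with ω h1 h2
  simp only [h1, h2, RCLike.inner_apply, conj_trivial, mul_comm]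

/-- Moving `K⁻¹` across the dot product writes the predictor as a linear combination of the
observations with deterministic weights, so the error is the squared norm of an element of `L²`. -/
theorem krigingMSE_eq {ψ : (Fin d → ℝ) → Lp ℝ 2 P} (hψ : ∀ x ∈ openCube d, ψ x =ᵐ[P] Y x)
    {D : Finset (Fin d → ℝ)} (hD : ∀ a ∈ D, a ∈ openCube d) {x : Fin d → ℝ}
    (hx : x ∈ openCube d) : krigingMSE k D Y P x = ENNReal.ofReal
      (‖ψ x - ∑ a : D, ((fun a : D => k x a) ᵥ* (kernelMatrix k D)⁻¹) a • ψ a‖ ^ 2) := by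
  set w := (fun a : D => k x a) ᵥ* (kernelMatrix k D)⁻¹ with hw
  set f : Lp ℝ 2 P := ψ x - ∑ a : D, w a • ψ a with hf
  have hsum : (∑ a : D, w a • ψ a : Lp ℝ 2 P) =ᵐ[P] fun ω => ∑ a : D, w a * Y a ω := by
    have h1 := Lp.coeFn_finsetSum (Finset.univ : Finset D) fun a => w a • ψ a
    have h2 : ∀ᵐ ω ∂P, ∀ a : D, (w a • ψ a : Lp ℝ 2 P) ω = w a * Y a ω := by
      refine ae_all_iff.2 fun a => ?_
      filter_upwards [Lp.coeFn_smul (w a) (ψ a), hψ a (hD a a.2)] with ω h3 h4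
      rw [h3, Pi.smul_apply, h4, smul_eq_mul]
    filter_upwards [h1, h2] with ω h3 h4
    rw [h3, Finset.sum_apply]
    exact Finset.sum_congr rfl fun a _ => h4 a
  have hfY : f =ᵐ[P] fun ω => Y x ω - krigingPredictor k D Y x ω := by
    filter_upwards [Lp.coeFn_sub (ψ x) (∑ a : D, w a • ψ a), hsum, hψ x hx] with ω h1 h2 h3
    rw [h1, Pi.sub_apply, h2, h3, krigingPredictor, Matrix.dotProduct_mulVec]
    rfl
  have hint : Integrable (fun ω => f ω ^ 2) P := (Lp.memLp f).integrable_sq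
  have hnorm : ‖f‖ ^ 2 = ∫ ω, f ω ^ 2 ∂P := by
    rw [← real_inner_self_eq_norm_sq, L2.inner_def]
    refine integral_congr_ae (Filter.Eventually.of_forall fun ω => ?_)
    simp only [RCLike.inner_apply, conj_trivial, sq]
  rw [hnorm, ofReal_integral_eq_lintegral_ofReal hint
    (Filter.Eventually.of_forall fun ω => sq_nonneg _), krigingMSE]
  refine lintegral_congr_ae ?_
  filter_upwards [hfY] with ω h
  rw [h, ← neg_sub, neg_sq]

end GaussianProcess

/-! ### Error in terms of the level, and conversion from the level to `n` -/

theorem sparseGrid_subset_openCube {d τ : ℕ} {x : Fin d → ℝ} (hx : x ∈ sparseGrid d τ) :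
    x ∈ openCube d := by
  obtain ⟨l, -, -, h⟩ := mem_sparseGrid.1 hx
  exact fun j => dyadicDesign_subset_Ioo (h j)

/-- The kriging error on any design containing a sparse grid of level `τ`. -/
theorem exists_krigingMSE_le {e : ℕ} {Ω : Type*} [MeasurableSpace Ω] {P : Measure Ω}
    [IsProbabilityMeasure P] {p q : Fin (e + 1) → ℝ → ℝ} (hTM : IsTensorMarkov p q)
    (hp : ∀ j, ContDiffOn ℝ 1 (p j) (Set.Icc 0 1)) (hq : ∀ j, ContDiffOn ℝ 1 (q j) (Set.Icc 0 1))
    {Y : (Fin (e + 1) → ℝ) → Ω → ℝ} (hY : IsCenteredGP Y (tmKernel p q) P) :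
    ∃ C : ℝ, 0 ≤ C ∧ ∀ (τ : ℕ) (D : Finset (Fin (e + 1) → ℝ)), sparseGrid (e + 1) τ ⊆ D →
      (∀ a ∈ D, a ∈ openCube (e + 1)) → ∀ x ∈ openCube (e + 1),
        krigingMSE (tmKernel p q) D Y P x ≤
          ENNReal.ofReal (C * ((τ : ℝ) + 1) ^ e * (1 / 2) ^ τ) := by
  obtain ⟨ψ, hψY, hψ⟩ := hY.exists_featureMap
  choose φ hφ using fun j =>
    exists_markov_featureMap (hTM.p_pos j) (hTM.q_pos j) (hTM.strictMono_div j)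
  choose M hM₁ hM₂ using fun j => exists_markov_kernel_bound (hp j) (hq j)
  obtain ⟨B, hB⟩ := (Set.finite_range M).bddAbove
  have hMB : ∀ j, M j ≤ B := fun j => hB ⟨j, rfl⟩
  have hφB : ∀ j, ∀ x ∈ Set.Ioo (0 : ℝ) 1, ‖φ j x‖ ^ 2 ≤ B := by
    intro j x hx
    rw [← real_inner_self_eq_norm_sq, hφ j x hx x hx, min_self, max_self]
    exact (hM₁ j x hx).trans (hMB j)
  have hφL : ∀ j, ∀ x ∈ Set.Ioo (0 : ℝ) 1, ∀ a ∈ Set.Ioo (0 : ℝ) 1,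
      ‖φ j x - φ j a‖ ^ 2 ≤ B * |x - a| := fun j x hx a ha =>
    (norm_sub_sq_le_of_markov (hφ j) (hM₂ j) hx ha).trans
      (mul_le_mul_of_nonneg_right (hMB j) (abs_nonneg _))
  have hB0 : 0 ≤ B := (sq_nonneg _).trans (hφB 0 (1 / 2) (by norm_num))
  have hk : ∀ a ∈ openCube (e + 1), ∀ b ∈ openCube (e + 1),
      inner ℝ (ψ a) (ψ b) = ∏ j, inner ℝ (φ j (a j)) (φ j (b j)) := by
    intro a ha b hb
    rw [hψ a ha b hb, tmKernel]
    exact Finset.prod_congr rfl fun j _ => (hφ j _ (ha j) _ (hb j)).symm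
  obtain ⟨C, hC0, hC⟩ := exists_sum_half_pow_le e
  refine ⟨B ^ (e + 1) * C, by positivity, fun τ D hτD hD x hx => ?_⟩
  have hkD : ∀ a ∈ D, ∀ b ∈ D, inner ℝ (ψ a) (ψ b) = tmKernel p q a b :=
    fun a ha b hb => hψ a (hD a ha) b (hD b hb)
  have hdet : IsUnit (kernelMatrix (tmKernel p q) D).det :=
    isUnit_det_kernelMatrix hkD fun c hc => eq_zero_of_sum_smul_eq_zero hTM hφ hk hD hc
  obtain ⟨v, hv, hvle⟩ :=
    exists_mem_span_sparseGrid_norm_sub_sq_le (Nat.le_add_left 1 e) hk hφB hφL τ hx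
  rw [krigingMSE_eq hψY hD hx]
  refine ENNReal.ofReal_le_ofReal ?_
  have h1 := norm_sub_kriging_le (x := x) hkD (fun b hb => hψ x hx b (hD b hb)) hdet
    (Submodule.span_mono (Set.image_mono (Finset.coe_subset.2 hτD)) hv)
  calc _ ≤ ‖ψ x - v‖ ^ 2 := pow_le_pow_left₀ (norm_nonneg _) h1 2
    _ ≤ _ := hvle
    _ ≤ B ^ (e + 1) * (C * ((τ : ℝ) + 1) ^ e * (1 / 2) ^ τ) :=
        mul_le_mul_of_nonneg_left (hC τ _ fun l hl => (Finset.mem_filter.1 hl).2) (by positivity)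
    _ = _ := by ring

theorem level_add_one_le_log {τ n : ℕ} (hn : 3 ≤ n) (h : 2 ^ τ - 1 ≤ n) :
    (τ : ℝ) + 1 ≤ 5 * Real.log n := by
  have hn0 : (3 : ℝ) ≤ n := by exact_mod_cast hn
  -- For `n ≥ 3`, `n + 1 ≤ n²`, so `τ log 2 ≤ 2 log n`. Also `1 ≤ log n` since `3 > exp 1`, and `2 /
  -- log 2 + 1 < 5`.
  have h1 : 2 ^ τ ≤ n ^ 2 := by
    have : 2 ^ τ ≤ n + 1 := by omega
    nlinarith
  have h2 : (2 : ℝ) ^ τ ≤ (n : ℝ) ^ 2 := by exact_mod_cast h1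
  have h3 := Real.log_le_log (by positivity) h2
  rw [Real.log_pow, Real.log_pow] at h3
  push_cast at h3
  have h4 : 1 ≤ Real.log n := by
    rw [Real.le_log_iff_exp_le (by linarith)]
    linarith [Real.exp_one_lt_d9]
  nlinarith [Real.log_two_gt_d9, Nat.cast_nonneg (α := ℝ) τ]

/-- The level of a sparse grid expressed through an upper bound on the size of the next one. -/
theorem half_pow_le_of_lt_card {e τ n : ℕ} (hn : 0 < n)
    (h : n < (sparseGrid (e + 1) (τ + 1)).card) :
    (1 / 2 : ℝ) ^ τ ≤ ((e : ℝ) + 2) ^ e * 2 ^ (e + 2) * ((τ : ℝ) + 1) ^ e * (n : ℝ)⁻¹ := by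
  have h1 : n ≤ ((e + 2) * (τ + 1)) ^ e * 2 ^ (τ + 1 + e + 1) :=
    (h.le.trans (card_sparseGrid_le e (τ + 1))).trans
      (Nat.mul_le_mul_right _ (Nat.pow_le_pow_left (by nlinarith) e))
  have h2 : (n : ℝ) ≤ (((e : ℝ) + 2) * (τ + 1)) ^ e * 2 ^ (τ + 1 + e + 1) := by exact_mod_cast h1
  have hn' : (0 : ℝ) < n := by exact_mod_cast hn
  rw [← div_eq_mul_inv, le_div_iff₀ hn']
  calc (1 / 2 : ℝ) ^ τ * n
      ≤ (1 / 2) ^ τ * ((((e : ℝ) + 2) * (τ + 1)) ^ e * 2 ^ (τ + 1 + e + 1)) := by gcongr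
    _ = ((1 / 2) ^ τ * 2 ^ τ) * (((e : ℝ) + 2) ^ e * 2 ^ (e + 2) * ((τ : ℝ) + 1) ^ e) := by
        rw [mul_pow, show τ + 1 + e + 1 = τ + (e + 2) by ring, pow_add]
        ring
    _ = _ := by rw [← mul_pow]; norm_num

end TensorMarkov

theorem theorem1 {d : ℕ} (hd : 1 ≤ d) {Ω : Type*} [MeasurableSpace Ω]
    (P : Measure Ω) [IsProbabilityMeasure P] (p q : Fin d → ℝ → ℝ)
    (hTM : TensorMarkov.IsTensorMarkov p q)
    (hSL : TensorMarkov.SturmLiouvilleRegular p q)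
    (Y : (Fin d → ℝ) → Ω → ℝ)
    (hY : TensorMarkov.IsCenteredGP Y (TensorMarkov.tmKernel p q) P) :
    ∃ (C : ℝ) (N : ℕ), ∀ n : ℕ, N ≤ n → ∀ D : Finset (Fin d → ℝ),
      TensorMarkov.IsTruncatedSparseGrid d n D →
        (⨆ x ∈ TensorMarkov.openCube d,
            TensorMarkov.krigingMSE (TensorMarkov.tmKernel p q) D Y P x) ≤
          ENNReal.ofReal (C * (n : ℝ)⁻¹ * Real.log n ^ (2 * (d - 1))) := by
  obtain ⟨e, rfl⟩ : ∃ e, d = e + 1 := ⟨d - 1, by omega⟩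
  obtain ⟨C, hC0, hC⟩ := TensorMarkov.exists_krigingMSE_le hTM hSL.contDiffOn_p hSL.contDiffOn_q hY
  refine ⟨C * (((e : ℝ) + 2) ^ e * 2 ^ (e + 2)) * 5 ^ (2 * e), 3, fun n hn D hD => ?_⟩
  obtain ⟨τ, hτ, hle, hlt, A, hA, -, rfl⟩ := hD
  have hcube : ∀ a ∈ TensorMarkov.sparseGrid (e + 1) τ ∪ A, a ∈ TensorMarkov.openCube (e + 1) :=
    fun a ha =>
    (Finset.mem_union.1 ha).elim TensorMarkov.sparseGrid_subset_openCube fun h =>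
      TensorMarkov.sparseGrid_subset_openCube (Finset.mem_sdiff.1 (hA h)).1
  refine iSup₂_le fun x hx => (hC τ _ Finset.subset_union_left hcube x hx).trans
    (ENNReal.ofReal_le_ofReal ?_)
  have h1 := TensorMarkov.half_pow_le_of_lt_card (by omega) hlt
  have h2 := TensorMarkov.level_add_one_le_log hn
    ((TensorMarkov.two_pow_sub_one_le_card_sparseGrid hτ).trans hle)
  rw [Nat.add_sub_cancel]
  -- One factor `(τ + 1)^e` comes from the tail of the expansion, the other from trading `2^(-τ)`
  -- for `1 / n`.
  calc C * ((τ : ℝ) + 1) ^ e * (1 / 2) ^ τ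
      ≤ C * ((τ : ℝ) + 1) ^ e *
          (((e : ℝ) + 2) ^ e * 2 ^ (e + 2) * ((τ : ℝ) + 1) ^ e * (n : ℝ)⁻¹) := by gcongr
    _ = C * (((e : ℝ) + 2) ^ e * 2 ^ (e + 2)) * (n : ℝ)⁻¹ * ((τ : ℝ) + 1) ^ (2 * e) := by ring
    _ ≤ C * (((e : ℝ) + 2) ^ e * 2 ^ (e + 2)) * (n : ℝ)⁻¹ * (5 * Real.log n) ^ (2 * e) := by
        gcongr
    _ = _ := by rw [mul_pow]; ring
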